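/- All manifolds are smooth ($C^\infty$), real, finite-dimensional, without boundary and second countable; Lie groups are moreover Hausdorff. **Definitions.** A *Lie groupoid* is a groupoid $G$ over $G_0$ (source $\alpha$, target $\beta$, composition $b\circ a$ defined when $\alpha(b)=\beta(a)$) such that $G$ and $G_0$ are manifolds, $G_0$ and all the stars $\mathrm{St}_G x=\alpha^{-1}(x)$ are Hausdorff, $\alpha,\beta$ are surjective submersions, and composition is smooth on the submanifold of composable pairs. A *Lie group-groupoid* is a Lie groupoid in which $G$ and $G_0$ are Lie groups such that multiplication, unit and inversion are morphisms of Lie groupoids (so that in particular the interchange law $(b\circ a)(d\circ c)=(bd)\circ(ac)$ holds). A morphism of Lie group-groupoids is a groupoid morphism that is smooth and a group homomorphism on arrows and on objects. It is a *covering morphism* if for every object $x$ it restricts to a diffeomorphism of the star of $x$ onto the star of the image of $x$. For a connected Lie group $M$, let $\pi_1M$ be its fundamental groupoid: its objects are the points of $M$, its arrows are the homotopy classes relative to end points of paths in $M$, with source the initial point and target the end point. The set of arrows carries the topology whose basic open sets consist of all classes $[\lambda\cdot a\cdot\mu]$, where $a$ is a path, $\lambda$ is a path in an open neighbourhood $U$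 of its initial point, $\mu$ is a path in an open neighbourhood $V$ of its end point; the smooth structure that makes $(\alpha,\beta):\pi_1M\to M\times M$ a local diffeomorphism; and the group structure induced by pointwise multiplication of paths. **Proposition.** Let $\widetilde M$ and $M$ be connected Lie groups, and let $p:\widetilde M\to M$ be a homomorphism of Lie groups that is a smooth covering map (a surjective covering map which is a local diffeomorphism). Then $\pi_1\widetilde M$ and $\pi_1M$ are Lie group-groupoids, and $$\pi_1p:\pi_1\widetilde M\to\pi_1M,\qquad [a]\mapsto[p\circ a],$$ with $p$ on objects, is a covering morphism of Lie group-groupoids. Moreover, the map $$(\pi_1p,\alpha):\ \pi_1\widetilde M\ \to\ \pi_1M\;{}_{\alpha}\!\times_{p}\widetilde M=\{(a,x)\in \pi_1M\times\widetilde M \mid \alpha(a)=p(x)\}$$ is a diffeomorphism onto the fiber product. -/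

import Mathlib

open scoped Manifold ContDiff Topology

/-! ### Groupoids, in terms of arrows and objects -/

/-- A groupoid with set of arrows `G` and set of objects `G₀`.  The composite `comp b a _` is
`b ∘ a`, first `a` and then `b`; it is defined when the source of `b` is the target of `a`. -/
structure ArrowGroupoid (G G₀ : Type*) where
  src : G → G₀
  tgt : G → G₀
  unit : G₀ → G
  inv : G → G
  comp : (b a : G) → src b = tgt a → G
  src_comp : ∀ b a h, src (comp b a h) = src a
  tgt_comp : ∀ b a h, tgt (comp b a h) = tgt b
  assoc : ∀ c b a (hcb : src c = tgt b) (hba : src b = tgt a),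
    comp c (comp b a hba) (hcb.trans (tgt_comp b a hba).symm) =
      comp (comp c b hcb) a ((src_comp c b hcb).trans hba)
  src_unit : ∀ x, src (unit x) = x
  tgt_unit : ∀ x, tgt (unit x) = x
  comp_unit : ∀ a, comp a (unit (src a)) (tgt_unit _).symm = a
  unit_comp : ∀ a, comp (unit (tgt a)) a (src_unit _) = a
  src_inv : ∀ a, src (inv a) = tgt a
  tgt_inv : ∀ a, tgt (inv a) = src a
  inv_comp : ∀ a, comp (inv a) a (src_inv a) = unit (src a)
  comp_inv : ∀ a, comp a (inv a) (tgt_inv a).symm = unit (tgt a)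

namespace ArrowGroupoid

/-- The arrows that start at the object `x`. -/
def star {G G₀ : Type*} (𝒢 : ArrowGroupoid G G₀) (x : G₀) : Set G := {a | 𝒢.src a = x}

/-- The set of composable pairs `(b, a)`. -/
def composable {G G₀ : Type*} (𝒢 : ArrowGroupoid G G₀) : Set (G × G) :=
  {c | 𝒢.src c.1 = 𝒢.tgt c.2}

/-- The product of two groupoids, with componentwise structure. -/
def prod {G G₀ K K₀ : Type*} (𝒢 : ArrowGroupoid G G₀) (𝒦 : ArrowGroupoid K K₀) :
    ArrowGroupoid (G × K) (G₀ × K₀) where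
  src a := (𝒢.src a.1, 𝒦.src a.2)
  tgt a := (𝒢.tgt a.1, 𝒦.tgt a.2)
  unit x := (𝒢.unit x.1, 𝒦.unit x.2)
  inv a := (𝒢.inv a.1, 𝒦.inv a.2)
  comp b a h := (𝒢.comp b.1 a.1 (congrArg Prod.fst h), 𝒦.comp b.2 a.2 (congrArg Prod.snd h))
  src_comp _ _ _ := Prod.ext (𝒢.src_comp _ _ _) (𝒦.src_comp _ _ _)
  tgt_comp _ _ _ := Prod.ext (𝒢.tgt_comp _ _ _) (𝒦.tgt_comp _ _ _)
  assoc _ _ _ _ _ := Prod.ext (𝒢.assoc _ _ _ _ _) (𝒦.assoc _ _ _ _ _)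
  src_unit _ := Prod.ext (𝒢.src_unit _) (𝒦.src_unit _)
  tgt_unit _ := Prod.ext (𝒢.tgt_unit _) (𝒦.tgt_unit _)
  comp_unit _ := Prod.ext (𝒢.comp_unit _) (𝒦.comp_unit _)
  unit_comp _ := Prod.ext (𝒢.unit_comp _) (𝒦.unit_comp _)
  src_inv _ := Prod.ext (𝒢.src_inv _) (𝒦.src_inv _)
  tgt_inv _ := Prod.ext (𝒢.tgt_inv _) (𝒦.tgt_inv _)
  inv_comp _ := Prod.ext (𝒢.inv_comp _) (𝒦.inv_comp _)
  comp_inv _ := Prod.ext (𝒢.comp_inv _) (𝒦.comp_inv _)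

/-- The groupoid with one object and one arrow. -/
def point : ArrowGroupoid Unit Unit where
  src _ := ()
  tgt _ := ()
  unit _ := ()
  inv _ := ()
  comp _ _ _ := ()
  src_comp _ _ _ := rfl
  tgt_comp _ _ _ := rfl
  assoc _ _ _ _ _ := rfl
  src_unit _ := rfl
  tgt_unit _ := rfl
  comp_unit _ := rfl
  unit_comp _ := rfl
  src_inv _ := rfl
  tgt_inv _ := rfl
  inv_comp _ := rfl
  comp_inv _ := rfl

/-- The pair `(f, f₀)` is a morphism of groupoids from `𝒢` to `𝒦`. -/
structure IsMorphism {G G₀ K K₀ : Type*} (𝒢 : ArrowGroupoid G G₀) (𝒦 : ArrowGroupoid K K₀)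
    (f : G → K) (f₀ : G₀ → K₀) : Prop where
  src_map : ∀ a, 𝒦.src (f a) = f₀ (𝒢.src a)
  tgt_map : ∀ a, 𝒦.tgt (f a) = f₀ (𝒢.tgt a)
  map_comp : ∀ b a (h : 𝒢.src b = 𝒢.tgt a),
    f (𝒢.comp b a h) =
      𝒦.comp (f b) (f a) ((src_map b).trans ((congrArg f₀ h).trans (tgt_map a).symm))

end ArrowGroupoid

/-! ### Manifolds and smooth maps between subsets of manifolds -/

section Smooth

variable {E H E' H' : Type*}
  [NormedAddCommGroup E] [NormedSpace ℝ E] [TopologicalSpace H]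
  [NormedAddCommGroup E'] [NormedSpace ℝ E'] [TopologicalSpace H']

/-- Smooth, second countable manifold of finite dimension, without boundary. -/
structure IsSmoothManifold (I : ModelWithCorners ℝ E H) (M : Type*) [TopologicalSpace M]
    [ChartedSpace H M] : Prop where
  finiteDimensional : FiniteDimensional ℝ E
  boundaryless : I.Boundaryless
  isManifold : IsManifold I ∞ M
  secondCountable : SecondCountableTopology M

/-- A map on a subset `S` of a manifold `A` is smooth if, near each point of `S`, it extends to
a smooth map on an open subset of `A`.  When `S` is an embedded submanifold of `A` this is
smoothness for the submanifold structure. -/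
def IsSmoothOnSubset (I : ModelWithCorners ℝ E H) (I' : ModelWithCorners ℝ E' H')
    {A B : Type*} [TopologicalSpace A] [ChartedSpace H A] [TopologicalSpace B] [ChartedSpace H' B]
    (S : Set A) (f : S → B) : Prop :=
  ∀ x : S, ∃ (U : Set A) (F : A → B), IsOpen U ∧ x.1 ∈ U ∧ ContMDiffOn I I' ∞ F U ∧
    ∀ y : S, y.1 ∈ U → F y.1 = f y

/-- The map `f` restricts to a diffeomorphism of the subset `S` onto the subset `T`. -/
def RestrictsToDiffeo (I : ModelWithCorners ℝ E H) (I' : ModelWithCorners ℝ E' H')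
    {A B : Type*} [TopologicalSpace A] [ChartedSpace H A] [TopologicalSpace B] [ChartedSpace H' B]
    (f : A → B) (S : Set A) (T : Set B) : Prop :=
  ∃ e : S ≃ T, (∀ x : S, (e x : B) = f x) ∧
    IsSmoothOnSubset I I' S (fun x => (e x : B)) ∧
    IsSmoothOnSubset I' I T (fun y => (e.symm y : A))

/-- Smooth covering maps: surjective covering maps that are diffeomorphisms on the sheets. -/
structure IsSmoothCovering (I : ModelWithCorners ℝ E H) (I' : ModelWithCorners ℝ E' H')
    {A B : Type*} [TopologicalSpace A] [ChartedSpace H A] [TopologicalSpace B] [ChartedSpace H' B]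
    (p : A → B) : Prop where
  surjective : Function.Surjective p
  isCoveringMap : IsCoveringMap p
  isLocalDiffeomorph : IsLocalDiffeomorph I I' ∞ p

end Smooth

/-! ### Lie groupoids and Lie group-groupoids -/

section LieGroupoids

variable {E H E₀ H₀ F K F₀ K₀ : Type*}
  [NormedAddCommGroup E] [NormedSpace ℝ E] [TopologicalSpace H]
  [NormedAddCommGroup E₀] [NormedSpace ℝ E₀] [TopologicalSpace H₀]
  [NormedAddCommGroup F] [NormedSpace ℝ F] [TopologicalSpace K]
  [NormedAddCommGroup F₀] [NormedSpace ℝ F₀] [TopologicalSpace K₀]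

/-- Lie groupoids: the arrows (modelled on `I`) and the objects (modelled on `I₀`) form manifolds,
the object manifold and the stars are Hausdorff, source and target are surjective submersions
and the composition is smooth on the submanifold of composable pairs. -/
structure IsLieGroupoid (I : ModelWithCorners ℝ E H) (I₀ : ModelWithCorners ℝ E₀ H₀)
    {G G₀ : Type*} [TopologicalSpace G] [ChartedSpace H G]
    [TopologicalSpace G₀] [ChartedSpace H₀ G₀] (𝒢 : ArrowGroupoid G G₀) : Prop where
  manifold_arrows : IsSmoothManifold I G
  manifold_objects : IsSmoothManifold I₀ G₀
  t2_objects : T2Space G₀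
  t2_star : ∀ x : G₀, T2Space (𝒢.star x)
  src_surjective : Function.Surjective 𝒢.src
  tgt_surjective : Function.Surjective 𝒢.tgt
  src_submersion : Manifold.IsSubmersion I I₀ ∞ 𝒢.src
  tgt_submersion : Manifold.IsSubmersion I I₀ ∞ 𝒢.tgt
  comp_smooth : IsSmoothOnSubset (I.prod I) I 𝒢.composable (fun c => 𝒢.comp c.1.1 c.1.2 c.2)

/-- Morphisms of Lie groupoids: morphisms of groupoids that are smooth on arrows and objects. -/
structure IsLieGroupoidMorphism (I : ModelWithCorners ℝ E H) (I₀ : ModelWithCorners ℝ E₀ H₀)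
    (J : ModelWithCorners ℝ F K) (J₀ : ModelWithCorners ℝ F₀ K₀)
    {G G₀ L L₀ : Type*} [TopologicalSpace G] [ChartedSpace H G]
    [TopologicalSpace G₀] [ChartedSpace H₀ G₀] [TopologicalSpace L] [ChartedSpace K L]
    [TopologicalSpace L₀] [ChartedSpace K₀ L₀]
    (𝒢 : ArrowGroupoid G G₀) (ℒ : ArrowGroupoid L L₀) (f : G → L) (f₀ : G₀ → L₀) : Prop where
  isMorphism : 𝒢.IsMorphism ℒ f f₀
  smooth_arrows : ContMDiff I J ∞ f
  smooth_objects : ContMDiff I₀ J₀ ∞ f₀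

/-- Lie group-groupoids: Lie groupoids whose arrows and objects form Lie groups such that the
multiplication, the unit and the inversion are morphisms of Lie groupoids; the group operation,
which need not be commutative, is written multiplicatively. -/
structure IsLieGroupGroupoid (I : ModelWithCorners ℝ E H) (I₀ : ModelWithCorners ℝ E₀ H₀)
    {G G₀ : Type*} [TopologicalSpace G] [ChartedSpace H G] [Group G]
    [TopologicalSpace G₀] [ChartedSpace H₀ G₀] [Group G₀] (𝒢 : ArrowGroupoid G G₀) : Prop where
  isLieGroupoid : IsLieGroupoid I I₀ 𝒢
  lieGroup_arrows : LieGroup I ∞ G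
  lieGroup_objects : LieGroup I₀ ∞ G₀
  mul_morphism : IsLieGroupoidMorphism (I.prod I) (I₀.prod I₀) I I₀ (𝒢.prod 𝒢) 𝒢
    (fun a => a.1 * a.2) (fun x => x.1 * x.2)
  one_morphism : ArrowGroupoid.point.IsMorphism 𝒢 (fun _ => 1) (fun _ => 1)
  inv_morphism : IsLieGroupoidMorphism I I₀ I I₀ 𝒢 𝒢 (fun a => a⁻¹) (fun x => x⁻¹)
  interchange : ∀ (b a d c : G) (hba : 𝒢.src b = 𝒢.tgt a) (hdc : 𝒢.src d = 𝒢.tgt c),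
    ∃ h : 𝒢.src (b * d) = 𝒢.tgt (a * c),
      𝒢.comp b a hba * 𝒢.comp d c hdc = 𝒢.comp (b * d) (a * c) h

/-- Morphisms of Lie group-groupoids: morphisms of Lie groupoids preserving the group structure. -/
structure IsLieGroupGroupoidMorphism (I : ModelWithCorners ℝ E H) (I₀ : ModelWithCorners ℝ E₀ H₀)
    (J : ModelWithCorners ℝ F K) (J₀ : ModelWithCorners ℝ F₀ K₀)
    {G G₀ L L₀ : Type*} [TopologicalSpace G] [ChartedSpace H G] [Group G]
    [TopologicalSpace G₀] [ChartedSpace H₀ G₀] [Group G₀]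
    [TopologicalSpace L] [ChartedSpace K L] [Group L]
    [TopologicalSpace L₀] [ChartedSpace K₀ L₀] [Group L₀]
    (𝒢 : ArrowGroupoid G G₀) (ℒ : ArrowGroupoid L L₀) (f : G → L) (f₀ : G₀ → L₀) : Prop where
  dom : IsLieGroupGroupoid I I₀ 𝒢
  cod : IsLieGroupGroupoid J J₀ ℒ
  isLieGroupoidMorphism : IsLieGroupoidMorphism I I₀ J J₀ 𝒢 ℒ f f₀
  map_mul_arrows : ∀ a b, f (a * b) = f a * f b
  map_mul_objects : ∀ x y, f₀ (x * y) = f₀ x * f₀ y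

/-- Covering morphisms of Lie group-groupoids: morphisms of Lie group-groupoids which restrict,
for every object `x`, to a diffeomorphism of the star of `x` onto the star of the image of `x`. -/
structure IsLieGroupGroupoidCovering (I : ModelWithCorners ℝ E H) (I₀ : ModelWithCorners ℝ E₀ H₀)
    (J : ModelWithCorners ℝ F K) (J₀ : ModelWithCorners ℝ F₀ K₀)
    {G G₀ L L₀ : Type*} [TopologicalSpace G] [ChartedSpace H G] [Group G]
    [TopologicalSpace G₀] [ChartedSpace H₀ G₀] [Group G₀]
    [TopologicalSpace L] [ChartedSpace K L] [Group L]
    [TopologicalSpace L₀] [ChartedSpace K₀ L₀] [Group L₀]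
    (𝒢 : ArrowGroupoid G G₀) (ℒ : ArrowGroupoid L L₀) (f : G → L) (f₀ : G₀ → L₀) : Prop where
  isMorphism : IsLieGroupGroupoidMorphism I I₀ J J₀ 𝒢 ℒ f f₀
  star_diffeo : ∀ x : G₀, RestrictsToDiffeo I J f (𝒢.star x) (ℒ.star (f₀ x))

end LieGroupoids

/-! ### The arrows of the fundamental groupoid -/

/-- An arrow of the fundamental groupoid of `X`: two points and a homotopy class, relative to the
end points, of paths between them. -/
structure FundArrow (X : Type*) [TopologicalSpace X] where
  src : X
  tgt : X
  path : Path.Homotopic.Quotient src tgt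

namespace FundArrow

section Topological

variable {X Y : Type*} [TopologicalSpace X] [TopologicalSpace Y]

/-- The arrow given by a path. -/
def ofPath {x y : X} (p : Path x y) : FundArrow X := ⟨x, y, .mk p⟩

theorem exists_ofPath (a : FundArrow X) : ∃ (x y : X) (p : Path x y), a = ofPath p := by
  obtain ⟨x, y, q⟩ := a
  induction q using Path.Homotopic.Quotient.ind with
  | mk p => exact ⟨x, y, p, rfl⟩

theorem ofPath_congr {x y x' y' : X} {p : Path x y} {q : Path x' y'} (h : ∀ t, p t = q t) :
    ofPath p = ofPath q := by
  have hx : x = x' := by simpa using h 0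
  have hy : y = y' := by simpa using h 1
  subst hx hy
  rw [show p = q from Path.ext (funext h)]

theorem ext_cast {a b : FundArrow X} (h₁ : a.src = b.src) (h₂ : a.tgt = b.tgt)
    (h : a.path = b.path.cast h₁ h₂) : a = b := by
  obtain ⟨x, y, q⟩ := a
  obtain ⟨x', y', q'⟩ := b
  dsimp at h₁ h₂
  subst h₁ h₂
  simpa using h

/-- The source and the target. -/
def ends (a : FundArrow X) : X × X := (a.src, a.tgt)

/-- Composition `b ∘ a`, by concatenation of paths, first `a` and then `b`. -/
noncomputable def comp (b a : FundArrow X) (h : b.src = a.tgt) : FundArrow X :=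
  ⟨a.src, b.tgt, a.path.trans (b.path.cast h.symm rfl)⟩

variable (X) in
/-- The fundamental groupoid of `X`. -/
noncomputable def groupoid : ArrowGroupoid (FundArrow X) X where
  src := src
  tgt := tgt
  unit x := ⟨x, x, .refl x⟩
  inv a := ⟨a.tgt, a.src, a.path.symm⟩
  comp := comp
  src_comp _ _ _ := rfl
  tgt_comp _ _ _ := rfl
  assoc := by
    rintro ⟨z, w, r⟩ ⟨y, z', q⟩ ⟨x, y', p⟩ h h'
    dsimp at h h'
    subst h h'
    simp [comp]
  src_unit _ := rfl
  tgt_unit _ := rfl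
  comp_unit a := by simp [comp]
  unit_comp a := by simp [comp]
  src_inv _ := rfl
  tgt_inv _ := rfl
  inv_comp a := by simp [comp]
  comp_inv a := by simp [comp]

/-- The map on arrows of fundamental groupoids induced by a continuous map. -/
def map (f : C(X, Y)) (a : FundArrow X) : FundArrow Y := ⟨f a.src, f a.tgt, a.path.map f⟩

/-- The arrows obtained from `a` by a small change of its end points: those that are the composite
of a path in `U`, the arrow `a`, and a path in `V`. -/
def sheet (U : Set X) (a : FundArrow X) (V : Set X) : Set (FundArrow X) :=
  {c | ∃ (l : Path c.src a.src) (r : Path a.tgt c.tgt), (∀ t, l t ∈ U) ∧ (∀ t, r t ∈ V) ∧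
    c.path = (Path.Homotopic.Quotient.mk l).trans (a.path.trans (.mk r))}

theorem sheet_mono {U U' V V' : Set X} (hU : U ⊆ U') (hV : V ⊆ V') (a : FundArrow X) :
    sheet U a V ⊆ sheet U' a V' := by
  rintro c ⟨l, r, hl, hr, h⟩
  exact ⟨l, r, fun t => hU (hl t), fun t => hV (hr t), h⟩

theorem mem_sheet_self {U V : Set X} {a : FundArrow X} (hU : a.src ∈ U) (hV : a.tgt ∈ V) :
    a ∈ sheet U a V :=
  ⟨.refl _, .refl _, fun _ => hU, fun _ => hV, by
    rw [Path.Homotopic.Quotient.mk_refl, Path.Homotopic.Quotient.mk_refl]; simp⟩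

theorem ends_mem_of_mem_sheet {U V : Set X} {a c : FundArrow X} (h : c ∈ sheet U a V) :
    c.src ∈ U ∧ c.tgt ∈ V := by
  obtain ⟨l, r, hl, hr, -⟩ := h
  exact ⟨by simpa using hl 0, by simpa using hr 1⟩

theorem trans_mem {x y z : X} {p : Path x y} {q : Path y z} {U : Set X} (hp : ∀ t, p t ∈ U)
    (hq : ∀ t, q t ∈ U) (t : unitInterval) : p.trans q t ∈ U := by
  rw [Path.trans_apply]
  split_ifs
  · exact hp _
  · exact hq _

theorem sheet_subset {U V : Set X} {a c : FundArrow X} (h : c ∈ sheet U a V) :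
    sheet U c V ⊆ sheet U a V := by
  obtain ⟨l, r, hl, hr, h⟩ := h
  rintro d ⟨l', r', hl', hr', h'⟩
  refine ⟨l'.trans l, r.trans r', trans_mem hl' hl, trans_mem hr hr', ?_⟩
  rw [h', h]
  simp

/-- The topology on the arrows of the fundamental groupoid, which has as a basis the sheets
`sheet U a V` with `U` and `V` open neighbourhoods of the end points of `a`. -/
instance instTopologicalSpace : TopologicalSpace (FundArrow X) where
  IsOpen S := ∀ a ∈ S, ∃ U V : Set X, IsOpen U ∧ IsOpen V ∧ a.src ∈ U ∧ a.tgt ∈ V ∧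
    sheet U a V ⊆ S
  isOpen_univ a _ := ⟨Set.univ, Set.univ, isOpen_univ, isOpen_univ, trivial, trivial,
    Set.subset_univ _⟩
  isOpen_inter S T hS hT a ha := by
    obtain ⟨U, V, hU, hV, haU, haV, h⟩ := hS a ha.1
    obtain ⟨U', V', hU', hV', haU', haV', h'⟩ := hT a ha.2
    exact ⟨U ∩ U', V ∩ V', hU.inter hU', hV.inter hV', ⟨haU, haU'⟩, ⟨haV, haV'⟩,
      Set.subset_inter
        ((sheet_mono Set.inter_subset_left Set.inter_subset_left a).trans h)
        ((sheet_mono Set.inter_subset_right Set.inter_subset_right a).trans h')⟩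
  isOpen_sUnion s hs a := by
    rintro ⟨S, hS, ha⟩
    obtain ⟨U, V, hU, hV, haU, haV, h⟩ := hs S hS a ha
    exact ⟨U, V, hU, hV, haU, haV, h.trans (Set.subset_sUnion_of_mem hS)⟩

theorem isOpen_def {S : Set (FundArrow X)} : IsOpen S ↔ ∀ a ∈ S, ∃ U V : Set X,
    IsOpen U ∧ IsOpen V ∧ a.src ∈ U ∧ a.tgt ∈ V ∧ sheet U a V ⊆ S := Iff.rfl

theorem isOpen_sheet {U V : Set X} (hU : IsOpen U) (hV : IsOpen V) (a : FundArrow X) :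
    IsOpen (sheet U a V) := fun _ hc =>
  ⟨U, V, hU, hV, (ends_mem_of_mem_sheet hc).1, (ends_mem_of_mem_sheet hc).2, sheet_subset hc⟩

theorem continuous_ends : Continuous (ends : FundArrow X → X × X) := by
  refine ⟨fun W hW => isOpen_def.2 fun a ha => ?_⟩
  obtain ⟨U, V, hU, hV, haU, haV, h⟩ := isOpen_prod_iff.1 hW a.src a.tgt ha
  exact ⟨U, V, hU, hV, haU, haV, fun c hc => h (ends_mem_of_mem_sheet hc)⟩

theorem isOpenMap_ends [LocallyPathConnectedSpace X] :
    IsOpenMap (ends : FundArrow X → X × X) := by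
  intro S hS
  rw [isOpen_iff_mem_nhds]
  rintro _ ⟨a, ha, rfl⟩
  obtain ⟨U, V, hU, hV, haU, haV, h⟩ := isOpen_def.1 hS a ha
  refine Filter.mem_of_superset (prod_mem_nhds (pathComponentIn_mem_nhds (hU.mem_nhds haU))
    (pathComponentIn_mem_nhds (hV.mem_nhds haV))) ?_
  rintro ⟨x, y⟩ ⟨hx, hy⟩
  obtain ⟨l, hl⟩ := JoinedIn.symm hx
  obtain ⟨r, hr⟩ := hy
  exact ⟨⟨x, y, (Path.Homotopic.Quotient.mk l).trans (a.path.trans (.mk r))⟩,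
    h ⟨l, r, hl, hr, rfl⟩, rfl⟩

/-- All paths in `U` with the same end points are homotopic in `X`. -/
def RelSimplyConnected (U : Set X) : Prop :=
  ∀ (x y : X) (p q : Path x y), (∀ t, p t ∈ U) → (∀ t, q t ∈ U) → p.Homotopic q

theorem injOn_ends {U V : Set X} (hU : RelSimplyConnected U) (hV : RelSimplyConnected V)
    (a : FundArrow X) : Set.InjOn ends (sheet U a V) := by
  rintro ⟨x, y, c⟩ ⟨l, r, hl, hr, h⟩ ⟨x', y', c'⟩ ⟨l', r', hl', hr', h'⟩ hcc
  obtain ⟨h₁, h₂⟩ := Prod.mk.inj hcc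
  dsimp at h₁ h₂
  subst h₁ h₂
  dsimp at h h' l l' r r'
  rw [h, h', Path.Homotopic.Quotient.eq.2 (hU _ _ l l' hl hl'),
    Path.Homotopic.Quotient.eq.2 (hV _ _ r r' hr hr')]

/-- In a locally path-connected space in which every point has an open neighbourhood that is
simply connected relative to the space, source and target form a local homeomorphism. -/
theorem isLocalHomeomorph_ends [LocallyPathConnectedSpace X]
    (hX : ∀ x : X, ∃ U, IsOpen U ∧ x ∈ U ∧ RelSimplyConnected U) :
    IsLocalHomeomorph (ends : FundArrow X → X × X) := by
  refine isLocalHomeomorph_iff_isOpenEmbedding_restrict.2 fun a => ?_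
  obtain ⟨U, hU, haU, hU'⟩ := hX a.src
  obtain ⟨V, hV, haV, hV'⟩ := hX a.tgt
  refine ⟨sheet U a V, (isOpen_sheet hU hV a).mem_nhds (mem_sheet_self haU haV), ?_⟩
  exact .of_continuous_injective_isOpenMap (continuous_ends.comp continuous_subtype_val)
    (Set.injOn_iff_injective.1 (injOn_ends hU' hV' a))
    (isOpenMap_ends.domRestrict (isOpen_sheet hU hV a))

end Topological

/-! ### The smooth structure -/

section Charts

theorem exists_relSimplyConnected (E : Type*) [NormedAddCommGroup E] [NormedSpace ℝ E]
    (M : Type*) [TopologicalSpace M] [ChartedSpace E M] (x : M) :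
    ∃ U, IsOpen U ∧ x ∈ U ∧ RelSimplyConnected U := by
  let φ := chartAt E x
  obtain ⟨r, hr, hball⟩ := Metric.isOpen_iff.1 φ.open_target (φ x) (mem_chart_target E x)
  refine ⟨φ.source ∩ φ ⁻¹' Metric.ball (φ x) r, φ.isOpen_inter_preimage Metric.isOpen_ball,
    ⟨mem_chart_source E x, Metric.mem_ball_self hr⟩, ?_⟩
  have := Metric.contractibleSpace_ball (x := φ x) hr
  let g : C(Metric.ball (φ x) r, M) := ⟨fun z => φ.symm z,
    (φ.continuousOn_symm.mono hball).domRestrict⟩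
  intro y z p q hp hq
  let lift : ∀ s : Path y z, (∀ t, s t ∈ φ.source ∩ φ ⁻¹' Metric.ball (φ x) r) →
      Path (⟨φ y, by simpa using (hp 0).2⟩ : Metric.ball (φ x) r)
        ⟨φ z, by simpa using (hp 1).2⟩ := fun s hs =>
    { toFun := fun t => ⟨φ (s t), (hs t).2⟩
      continuous_toFun := (φ.continuousOn.comp_continuous s.continuous
        fun t => (hs t).1).subtype_mk _
      source' := by simp
      target' := by simp }
  have key := (SimplyConnectedSpace.paths_homotopic (lift p hp) (lift q hq)).map g
  have hy : φ.symm (φ y) = y := φ.left_inv (by simpa using (hp 0).1)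
  have hz : φ.symm (φ z) = z := φ.left_inv (by simpa using (hp 1).1)
  have e₁ : ((lift p hp).map g.continuous).cast hy.symm hz.symm = p :=
    Path.ext (funext fun t => φ.left_inv (hp t).1)
  have e₂ : ((lift q hq).map g.continuous).cast hy.symm hz.symm = q :=
    Path.ext (funext fun t => φ.left_inv (hq t).1)
  rw [← e₁, ← e₂]
  exact key

theorem isLocalHomeomorph_ends_of_charted (E : Type*) [NormedAddCommGroup E] [NormedSpace ℝ E]
    (M : Type*) [TopologicalSpace M] [ChartedSpace E M] :
    IsLocalHomeomorph (ends : FundArrow M → M × M) :=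
  haveI : LocallyPathConnectedSpace M := ChartedSpace.locallyPathConnectedSpace E M
  isLocalHomeomorph_ends (exists_relSimplyConnected E M)

/-- The atlas lifted from the product manifold `M × M`: the charts are the composites of a local
inverse branch of `(src, tgt)` and a chart of `M × M`. -/
noncomputable instance instChartedSpace {E : Type*} [NormedAddCommGroup E] [NormedSpace ℝ E]
    {M : Type*} [TopologicalSpace M] [ChartedSpace E M] :
    ChartedSpace (ModelProd E E) (FundArrow M) where
  atlas := {e | ∃ d : OpenPartialHomeomorph (FundArrow M) (M × M), ends = d ∧
    ∃ c ∈ atlas (ModelProd E E) (M × M), e = d.trans c}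
  chartAt a := (isLocalHomeomorph_ends_of_charted E M a).choose.trans
    (chartAt (ModelProd E E) (ends a))
  mem_chart_source a := by
    obtain ⟨h₁, h₂⟩ := (isLocalHomeomorph_ends_of_charted E M a).choose_spec
    rw [OpenPartialHomeomorph.trans_source]
    refine ⟨h₁, ?_⟩
    rw [Set.mem_preimage, ← h₂]
    exact mem_chart_source _ _
  chart_mem_atlas a :=
    ⟨_, (isLocalHomeomorph_ends_of_charted E M a).choose_spec.2, _, chart_mem_atlas _ _, rfl⟩

end Charts

/-! ### The group structure -/

section Group

variable {M : Type*} [TopologicalSpace M] [Group M] [IsTopologicalGroup M]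

/-- The product of arrows, `[a] * [b] = [t ↦ a t * b t]`. -/
instance : Mul (FundArrow M) where
  mul a b := ⟨a.src * b.src, a.tgt * b.tgt,
    Quotient.map₂ Path.mul (fun _ _ ha _ _ hb =>
      (Nonempty.map2 Path.Homotopic.prodHomotopy ha hb).map fun F =>
        F.map ⟨fun x : M × M => x.1 * x.2, continuous_mul⟩) a.path b.path⟩

/-- The inverse of an arrow for the group structure, `[a]⁻¹ = [t ↦ (a t)⁻¹]`. -/
instance : Inv (FundArrow M) where
  inv a := ⟨a.src⁻¹, a.tgt⁻¹, a.path.map ⟨fun x : M => x⁻¹, continuous_inv⟩⟩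

/-- The constant path at the unit. -/
instance {M : Type*} [TopologicalSpace M] [One M] : One (FundArrow M) := ⟨ofPath (.refl 1)⟩

theorem ofPath_mul {x y x' y' : M} (p : Path x y) (q : Path x' y') :
    ofPath p * ofPath q = ofPath (p.mul q) := rfl

theorem ofPath_inv {x y : M} (p : Path x y) : (ofPath p)⁻¹ = ofPath p.inv := rfl

theorem one_def {M : Type*} [TopologicalSpace M] [One M] : (1 : FundArrow M) = ofPath (.refl 1) := rfl

instance instGroup : Group (FundArrow M) where
  mul_assoc a b c := by
    obtain ⟨_, _, p, rfl⟩ := a.exists_ofPath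
    obtain ⟨_, _, q, rfl⟩ := b.exists_ofPath
    obtain ⟨_, _, r, rfl⟩ := c.exists_ofPath
    simp only [ofPath_mul]
    exact ofPath_congr fun t => by simp [mul_assoc]
  one_mul a := by
    obtain ⟨_, _, p, rfl⟩ := a.exists_ofPath
    simp only [ofPath_mul, one_def]
    exact ofPath_congr fun t => by simp
  mul_one a := by
    obtain ⟨_, _, p, rfl⟩ := a.exists_ofPath
    simp only [ofPath_mul, one_def]
    exact ofPath_congr fun t => by simp
  inv_mul_cancel a := by
    obtain ⟨_, _, p, rfl⟩ := a.exists_ofPath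
    simp only [ofPath_mul, one_def, ofPath_inv]
    exact ofPath_congr fun t => by simp

end Group

end FundArrow

/-! The map `ends` is a local diffeomorphism, so a map into the arrows is smooth as soon as it is
continuous and its end points vary smoothly (`contMDiff_iff`). Continuity is checked on sheets,
where an arrow near `[γ]` is `[l·γ·r]` with `l` and `r` short. This makes the arrows a Lie group.

The group structure then gives the rest of the groupoid part. The interchange law yields `b ∘ a = b
* u⁻¹ * a` with `u` the unit at the target of `a` (`comp_eq_mul`), so composition is the restriction
of a globally smooth map. A T0 topological group is Hausdorff, and a connected one with a second
countable neighbourhood of 1 is second countable.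

For a covering `p`, the inverse of `(π₁p, α)` is path lifting. It is continuous because, when `γ`
lifts `a`, an arrow `l·a·r` near `a` lifts to `l'·γ·r'`, with `l'` and `r'` obtained from local
inverses of `p` (`continuous_lift`). It is smooth because its source is given and its target lies
over a smooth map. Fixing the source gives the statement on stars. -/

namespace FundArrow

/-! ### Topology of the arrows -/

section Topology

variable {X Y : Type*} [TopologicalSpace X] [TopologicalSpace Y]

/-- Describing sheets by representatives turns continuity proofs into computations with concatenated
paths. -/
theorem mem_sheet_ofPath {x y : X} {γ : Path x y} {U V : Set X} {c : FundArrow X} :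
    c ∈ sheet U (ofPath γ) V ↔ ∃ (x' y' : X) (l : Path x' x) (r : Path y y'),
      (∀ t, l t ∈ U) ∧ (∀ t, r t ∈ V) ∧ c = ofPath (l.trans (γ.trans r)) := by
  constructor
  · obtain ⟨x', y', q⟩ := c
    rintro ⟨l, r, hl, hr, h⟩
    refine ⟨x', y', l, r, hl, hr, ?_⟩
    dsimp at h
    rw [h]
    rfl
  · rintro ⟨x', y', l, r, hl, hr, rfl⟩
    exact ⟨l, r, hl, hr, rfl⟩

theorem exists_sheet_subset {S : Set (FundArrow X)} {a : FundArrow X} (hS : S ∈ 𝓝 a) :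
    ∃ U V : Set X, IsOpen U ∧ IsOpen V ∧ a.src ∈ U ∧ a.tgt ∈ V ∧ sheet U a V ⊆ S := by
  obtain ⟨T, hTS, hT, ha⟩ := mem_nhds_iff.1 hS
  obtain ⟨U, V, hU, hV, haU, haV, h⟩ := isOpen_def.1 hT a ha
  exact ⟨U, V, hU, hV, haU, haV, h.trans hTS⟩

theorem sheet_mem_nhds {U V : Set X} (hU : IsOpen U) (hV : IsOpen V) {a : FundArrow X}
    (haU : a.src ∈ U) (haV : a.tgt ∈ V) : sheet U a V ∈ 𝓝 a :=
  (isOpen_sheet hU hV a).mem_nhds (mem_sheet_self haU haV)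

theorem continuous_src : Continuous (src : FundArrow X → X) :=
  continuous_fst.comp continuous_ends

theorem continuous_tgt : Continuous (tgt : FundArrow X → X) :=
  continuous_snd.comp continuous_ends

theorem map_ofPath (f : C(X, Y)) {x y : X} (γ : Path x y) :
    map f (ofPath γ) = ofPath (γ.map f.continuous) := rfl

theorem map_mem_sheet (f : C(X, Y)) {a c : FundArrow X} {U V : Set Y}
    (hc : c ∈ sheet (f ⁻¹' U) a (f ⁻¹' V)) : map f c ∈ sheet U (map f a) V := by
  obtain ⟨x, y, γ, rfl⟩ := a.exists_ofPath
  obtain ⟨x', y', l, r, hl, hr, rfl⟩ := mem_sheet_ofPath.1 hc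
  rw [map_ofPath, mem_sheet_ofPath]
  exact ⟨_, _, l.map f.continuous, r.map f.continuous, hl, hr, by
    rw [map_ofPath, Path.map_trans, Path.map_trans]⟩

theorem continuous_map (f : C(X, Y)) : Continuous (map f) := by
  refine continuous_iff_continuousAt.2 fun a S hS => ?_
  obtain ⟨U, V, hU, hV, haU, haV, h⟩ := exists_sheet_subset hS
  exact Filter.mem_map.2 (Filter.mem_of_superset (sheet_mem_nhds (hU.preimage f.continuous)
    (hV.preimage f.continuous) haU haV) fun c hc => h (map_mem_sheet f hc))

theorem continuous_unit [LocallyPathConnectedSpace X] : Continuous (groupoid X).unit := by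
  refine continuous_iff_continuousAt.2 fun x S hS => ?_
  obtain ⟨U, V, hU, hV, haU, haV, h⟩ := exists_sheet_subset hS
  refine Filter.mem_map.2 (Filter.mem_of_superset
    (pathComponentIn_mem_nhds ((hU.inter hV).mem_nhds ⟨haU, haV⟩)) ?_)
  intro y hy
  obtain ⟨r, hr⟩ := hy
  -- Running `r` backwards to `x` and then forwards again is null-homotopic, which places the unit
  -- at `y` in the sheet of the unit at `x`.
  have key : Path.Homotopic.Quotient.refl y =
      (Path.Homotopic.Quotient.mk (Path.symm (x := x) r)).trans
        ((Path.Homotopic.Quotient.refl x).trans (.mk r)) := by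
    rw [Path.Homotopic.Quotient.mk_symm]
    simp
  exact h ⟨Path.symm (x := x) r, r, fun t => (hr _).1, fun t => (hr t).2, key⟩

/-- Inseparable arrows share a sheet and have the same end points, and `ends` is injective on a
small sheet. -/
theorem t0Space [LocallyPathConnectedSpace X] [T2Space X]
    (hX : ∀ x : X, ∃ U, IsOpen U ∧ x ∈ U ∧ RelSimplyConnected U) : T0Space (FundArrow X) := by
  refine ⟨fun a b hab => ?_⟩
  obtain ⟨U, hU, haU, hU'⟩ := hX a.src
  obtain ⟨V, hV, haV, hV'⟩ := hX a.tgt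
  have hb : b ∈ sheet U a V := (hab.mem_open_iff (isOpen_sheet hU hV a)).1 (mem_sheet_self haU haV)
  exact injOn_ends hU' hV' a (mem_sheet_self haU haV) hb (hab.map continuous_ends).eq

theorem injective_ends [SimplyConnectedSpace X] :
    Function.Injective (ends : FundArrow X → X × X) := by
  rintro ⟨x, y, a⟩ ⟨x', y', b⟩ h
  obtain ⟨h₁, h₂⟩ := Prod.mk.inj h
  dsimp at h₁ h₂
  subst h₁ h₂
  rw [Subsingleton.elim a b]

theorem surjective_ends [PathConnectedSpace X] :
    Function.Surjective (ends : FundArrow X → X × X) := fun x =>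
  ⟨ofPath (PathConnectedSpace.somePath x.1 x.2), rfl⟩

/-- Here `ends` is a homeomorphism onto `X × X`. The case needed is `X = ℝ`. -/
instance [SimplyConnectedSpace X] [LocallyPathConnectedSpace X] :
    ConnectedSpace (FundArrow X) :=
  ((Equiv.ofBijective ends ⟨injective_ends, surjective_ends⟩).toHomeomorphOfContinuousOpen
    continuous_ends isOpenMap_ends).symm.surjective.connectedSpace (Homeomorph.continuous _)

/-- The arrows of the fundamental groupoid of a connected, locally path-connected space form a
connected space: an arrow and the unit at its source are images of arrows of `π₁ ℝ`. -/
theorem connectedSpace [ConnectedSpace X] [LocallyPathConnectedSpace X] :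
    ConnectedSpace (FundArrow X) := by
  let u := (groupoid X).unit
  have key : ∀ a : FundArrow X, a ∈ connectedComponent (u a.src) := by
    intro a
    obtain ⟨x, y, γ, rfl⟩ := a.exists_ofPath
    -- The arrow of `γ` is the image under `map g` of the arrow of `ℝ` from 0 to 1, and the unit at
    -- `x` is the image of the unit at 0.
    let g : C(ℝ, X) := ⟨γ.extend, γ.continuous_extend⟩
    have hpre : IsPreconnected (Set.range (map g)) := isPreconnected_range (continuous_map g)
    let ι : Path (0 : ℝ) 1 := ⟨⟨fun t => t, continuous_subtype_val⟩, by simp, by simp⟩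
    refine hpre.subset_connectedComponent ⟨ofPath (.refl 0), ?_⟩ ⟨ofPath ι, ?_⟩
    · rw [map_ofPath]
      exact ofPath_congr (q := Path.refl x) fun t => by simp [g]
    · rw [map_ofPath]
      exact ofPath_congr fun t => by simp [g, ι]
  obtain ⟨x₀⟩ : Nonempty X := inferInstance
  have hu : ∀ x, u x ∈ connectedComponent (u x₀) := fun x =>
    (isPreconnected_range continuous_unit).subset_connectedComponent ⟨x₀, rfl⟩ ⟨x, rfl⟩
  refine connectedSpace_iff_connectedComponent.2 ⟨u x₀, Set.eq_univ_of_forall fun a => ?_⟩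
  exact connectedComponent_eq (hu a.src) ▸ key a

end Topology

/-! ### The topological group of arrows -/

section TopologicalGroup

variable {M : Type*} [TopologicalSpace M] [Group M] [IsTopologicalGroup M]

/-- Both concatenations switch at time 1/2, so the paths are equal and not merely homotopic. -/
theorem trans_mul_trans {x y z x' y' z' : M} (a : Path x y) (b : Path y z) (a' : Path x' y')
    (b' : Path y' z') : (a.trans b).mul (a'.trans b') = (a.mul a').trans (b.mul b') := by
  ext t
  simp only [Path.mul_apply, Path.trans_apply]
  split_ifs <;> rfl

theorem mul_mem_sheet {U V U₁ V₁ U₂ V₂ : Set M} {a b c d : FundArrow M}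
    (hU : ∀ x ∈ U₁, ∀ y ∈ U₂, x * y ∈ U) (hV : ∀ x ∈ V₁, ∀ y ∈ V₂, x * y ∈ V)
    (hc : c ∈ sheet U₁ a V₁) (hd : d ∈ sheet U₂ b V₂) : c * d ∈ sheet U (a * b) V := by
  obtain ⟨x, y, γ, rfl⟩ := a.exists_ofPath
  obtain ⟨x', y', δ, rfl⟩ := b.exists_ofPath
  obtain ⟨_, _, l, r, hl, hr, rfl⟩ := mem_sheet_ofPath.1 hc
  obtain ⟨_, _, l', r', hl', hr', rfl⟩ := mem_sheet_ofPath.1 hd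
  rw [ofPath_mul, mem_sheet_ofPath]
  exact ⟨_, _, l.mul l', r.mul r', fun t => hU _ (hl t) _ (hl' t), fun t => hV _ (hr t) _ (hr' t),
    by rw [ofPath_mul, trans_mul_trans, trans_mul_trans]⟩

instance : IsTopologicalGroup (FundArrow M) where
  continuous_mul := by
    refine continuous_iff_continuousAt.2 fun ⟨a, b⟩ S hS => ?_
    obtain ⟨U, V, hU, hV, haU, haV, h⟩ := exists_sheet_subset hS
    obtain ⟨U₁, U₂, hU₁, hU₂, haU₁, haU₂, hUU⟩ :=
      isOpen_prod_iff.1 (hU.preimage continuous_mul) a.src b.src haU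
    obtain ⟨V₁, V₂, hV₁, hV₂, haV₁, haV₂, hVV⟩ :=
      isOpen_prod_iff.1 (hV.preimage continuous_mul) a.tgt b.tgt haV
    refine Filter.mem_map.2 (Filter.mem_of_superset
      (prod_mem_nhds (sheet_mem_nhds hU₁ hV₁ haU₁ haV₁) (sheet_mem_nhds hU₂ hV₂ haU₂ haV₂)) ?_)
    rintro ⟨c, d⟩ ⟨hc, hd⟩
    exact h (mul_mem_sheet (fun x hx y hy => @hUU (x, y) ⟨hx, hy⟩)
      (fun x hx y hy => @hVV (x, y) ⟨hx, hy⟩) hc hd)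
  continuous_inv := continuous_map ⟨fun x : M => x⁻¹, continuous_inv⟩

/-- The interchange law between composition and multiplication of arrows. -/
theorem comp_mul_comp (b a d c : FundArrow M) (hba : b.src = a.tgt) (hdc : d.src = c.tgt) :
    comp b a hba * comp d c hdc = comp (b * d) (a * c) (congrArg₂ (· * ·) hba hdc) := by
  obtain ⟨x, y, p⟩ := a
  obtain ⟨y', z, q⟩ := b
  obtain ⟨x', w, r⟩ := c
  obtain ⟨w', v, s⟩ := d
  dsimp at hba hdc
  subst hba hdc
  induction p using Path.Homotopic.Quotient.ind with | mk p
  induction q using Path.Homotopic.Quotient.ind with | mk q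
  induction r using Path.Homotopic.Quotient.ind with | mk r
  induction s using Path.Homotopic.Quotient.ind with | mk s
  exact congrArg ofPath (trans_mul_trans p q r s)

theorem comp_eq_left {X : Type*} [TopologicalSpace X] {a e : FundArrow X}
    (he : e = (groupoid X).unit a.src) (h : a.src = e.tgt) : comp a e h = a := by
  subst he
  exact (groupoid X).comp_unit a

/-- The composition of arrows is determined by their multiplication. -/
theorem comp_eq_mul (b a : FundArrow M) (h : b.src = a.tgt) :
    comp b a h = b * ((groupoid M).unit a.tgt)⁻¹ * a := by
  set u := (groupoid M).unit a.tgt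
  -- Translating `b` by `u⁻¹` moves its source to 1, which makes it composable with the arrow 1, the
  -- unit at the object 1.
  have hk : (b * u⁻¹).src = 1 := by
    show b.src * (a.tgt)⁻¹ = 1
    rw [h, mul_inv_cancel]
  have h₁ : comp (b * u⁻¹) 1 hk = b * u⁻¹ := comp_eq_left (by rw [hk]; rfl) _
  have h₂ : comp u a rfl = a := (groupoid M).unit_comp a
  -- Interchange: `((b * u⁻¹) ∘ 1) * (u ∘ a) = (b * u⁻¹ * u) ∘ (1 * a) = b ∘ a`.
  have := comp_mul_comp (b * u⁻¹) 1 u a hk rfl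
  rw [h₁, h₂] at this
  rw [this]
  congr 1 <;> simp

end TopologicalGroup

end FundArrow

/-- A connected topological group which is locally, at the unit, homeomorphic to a second countable
space is second countable. -/
theorem secondCountableTopology_of_chart_at_one {G Y : Type*} [TopologicalSpace G] [Group G]
    [IsTopologicalGroup G] [ConnectedSpace G] [TopologicalSpace Y] [SecondCountableTopology Y]
    (e : OpenPartialHomeomorph G Y) (he : 1 ∈ e.source) : SecondCountableTopology G := by
  have := e.secondCountableTopology_source
  obtain ⟨D, hD, hDW⟩ : TopologicalSpace.IsSeparable e.source := .of_subtype _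
  let C := Subgroup.closure D
  have : Countable D := hD
  have : Countable (FreeGroup D) := Quot.mk_surjective.countable
  have : Countable C := by
    show Countable (Subgroup.closure D)
    rw [FreeGroup.closure_eq_range]
    exact (FreeGroup.lift ((↑) : D → G)).rangeRestrict_surjective.countable
  -- The closure of `C` contains the chart domain, hence is an open subgroup. Being clopen in a
  -- connected group, it is everything.
  have hK : (C.topologicalClosure : Set G) = Set.univ := by
    have h₁ : IsOpen (C.topologicalClosure : Set G) := by
      refine Subgroup.isOpen_of_mem_nhds _ (g := 1) ?_
      exact Filter.mem_of_superset (e.open_source.mem_nhds he)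
        (hDW.trans (closure_mono Subgroup.subset_closure))
    exact IsClopen.eq_univ ⟨C.isClosed_topologicalClosure, h₁⟩ ⟨1, one_mem _⟩
  -- The translates of the chart by the countable dense subgroup `C` cover `G`: for `g` in `C` close
  -- to `x`, `g⁻¹ * x` is close to 1.
  let t : C → OpenPartialHomeomorph G Y := fun g =>
    (Homeomorph.mulLeft (g : G)⁻¹).toOpenPartialHomeomorph.trans e
  have : ∀ g, SecondCountableTopology (t g).source := fun g =>
    (t g).secondCountableTopology_source
  refine TopologicalSpace.secondCountableTopology_of_countable_cover
    (U := fun g => (t g).source) (fun g => (t g).open_source) (Set.eq_univ_of_forall fun x => ?_)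
  have hx : x ∈ closure (C : Set G) := by
    rw [← Subgroup.topologicalClosure_coe, hK]; trivial
  have hN : (fun g : G => g⁻¹ * x) ⁻¹' e.source ∈ 𝓝 x :=
    (Continuous.mul continuous_inv continuous_const).continuousAt.preimage_mem_nhds
      (by simpa using e.open_source.mem_nhds he)
  obtain ⟨g, hg, hgC⟩ := mem_closure_iff_nhds.1 hx _ hN
  exact Set.mem_iUnion.2 ⟨⟨g, hgC⟩, by simpa [t] using hg⟩

/-! ### Smoothness of maps into the domain of a local diffeomorphism -/

section Smooth

variable {E H E' H' F K : Type*}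
  [NormedAddCommGroup E] [NormedSpace ℝ E] [TopologicalSpace H]
  [NormedAddCommGroup E'] [NormedSpace ℝ E'] [TopologicalSpace H']
  [NormedAddCommGroup F] [NormedSpace ℝ F] [TopologicalSpace K]
  {I : ModelWithCorners ℝ E H} {I' : ModelWithCorners ℝ E' H'} {J : ModelWithCorners ℝ F K}
  {A B N : Type*} [TopologicalSpace A] [ChartedSpace H A] [TopologicalSpace B] [ChartedSpace H' B]
  [TopologicalSpace N] [ChartedSpace K N]

theorem ContMDiff.isSmoothOnSubset {f : A → B} (hf : ContMDiff I I' ∞ f) (S : Set A) :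
    IsSmoothOnSubset I I' S (fun x => f x) := fun _ =>
  ⟨Set.univ, f, isOpen_univ, trivial, hf.contMDiffOn, fun _ _ => rfl⟩

/-- A continuous map on a subset is smooth if its composite with a local diffeomorphism is. -/
theorem IsSmoothOnSubset.of_comp_isLocalDiffeomorph {q : N → B}
    (hq : IsLocalDiffeomorph J I' ∞ q) {S : Set A} {f : S → N} (hf : Continuous f)
    (h : IsSmoothOnSubset I I' S (q ∘ f)) : IsSmoothOnSubset I J S f := by
  intro x
  obtain ⟨U, F, hU, hxU, hF, hFf⟩ := h x
  obtain ⟨d, hxd, hd⟩ := hq (f x)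
  obtain ⟨W, hW, hWd⟩ := isOpen_induced_iff.1 (d.open_source.preimage hf)
  have hxW : x.1 ∈ W := by
    have : x ∈ Subtype.val ⁻¹' W := by rw [hWd]; exact hxd
    exact this
  have hmem : ∀ y : S, y.1 ∈ W → f y ∈ d.source := fun y hy => by
    have : y ∈ f ⁻¹' d.source := by rw [← hWd]; exact hy
    exact this
  -- The extension is `d⁻¹ ∘ F`. On `W` the values of `f` stay in the branch `d`, so `d⁻¹` recovers
  -- them; the last factor keeps `F` where `d⁻¹` is smooth.
  refine ⟨(U ∩ W) ∩ F ⁻¹' d.target, fun z => d.invFun (F z), ?_, ⟨⟨hxU, hxW⟩, ?_⟩, ?_, ?_⟩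
  · exact (hF.continuousOn.mono Set.inter_subset_left).isOpen_inter_preimage (hU.inter hW)
      d.open_target
  · show F x.1 ∈ d.target
    rw [hFf x hxU, Function.comp_apply, hd hxd]
    exact d.map_source hxd
  · exact d.contMDiffOn_invFun.comp
      (hF.mono fun z hz => hz.1.1) fun z hz => hz.2
  · rintro y ⟨⟨hyU, hyW⟩, -⟩
    show d.invFun (F y.1) = f y
    rw [hFf y hyU, Function.comp_apply, hd (hmem y hyW)]
    exact d.left_inv (hmem y hyW)

end Smooth

namespace FundArrow

/-! ### The smooth structure on the arrows -/

section Manifold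

variable {E : Type*} [NormedAddCommGroup E] [NormedSpace ℝ E]
  {M : Type*} [TopologicalSpace M] [ChartedSpace E M]
  {F K : Type*} [NormedAddCommGroup F] [NormedSpace ℝ F] [TopologicalSpace K]
  {J : ModelWithCorners ℝ F K} {N : Type*} [TopologicalSpace N] [ChartedSpace K N]

/-- Each inverse branch has `ends` itself as underlying function, so the equation holds even for `b`
outside the chart domain. -/
theorem chartAt_apply (a b : FundArrow M) :
    chartAt (ModelProd E E) a b = chartAt (ModelProd E E) (ends a) (ends b) := by
  show (chartAt (ModelProd E E) (ends a)) ((isLocalHomeomorph_ends_of_charted E M a).choose b) = _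
  rw [← (isLocalHomeomorph_ends_of_charted E M a).choose_spec.2]

theorem extChartAt_apply (a b : FundArrow M) :
    extChartAt (𝓘(ℝ, E).prod 𝓘(ℝ, E)) a b =
      extChartAt (𝓘(ℝ, E).prod 𝓘(ℝ, E)) (ends a) (ends b) := by
  simp only [extChartAt, OpenPartialHomeomorph.extend_coe, Function.comp_apply, chartAt_apply]

/-- A map to the arrows of the fundamental groupoid is smooth if and only if it is continuous
and the end points depend smoothly on the parameter. -/
theorem contMDiffAt_iff {f : N → FundArrow M} {x : N} :
    ContMDiffAt J (𝓘(ℝ, E).prod 𝓘(ℝ, E)) ∞ f x ↔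
      ContinuousAt f x ∧ ContMDiffAt J (𝓘(ℝ, E).prod 𝓘(ℝ, E)) ∞ (ends ∘ f) x := by
  rw [_root_.contMDiffAt_iff, _root_.contMDiffAt_iff]
  have : extChartAt (𝓘(ℝ, E).prod 𝓘(ℝ, E)) (f x) ∘ f ∘ (extChartAt J x).symm =
      extChartAt (𝓘(ℝ, E).prod 𝓘(ℝ, E)) ((ends ∘ f) x) ∘ (ends ∘ f) ∘ (extChartAt J x).symm :=
    funext fun y => extChartAt_apply _ _
  rw [this]
  exact ⟨fun h => ⟨h.1, continuous_ends.continuousAt.comp h.1, h.2⟩, fun h => ⟨h.1, h.2.2⟩⟩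

theorem contMDiff_iff {f : N → FundArrow M} :
    ContMDiff J (𝓘(ℝ, E).prod 𝓘(ℝ, E)) ∞ f ↔
      Continuous f ∧ ContMDiff J (𝓘(ℝ, E).prod 𝓘(ℝ, E)) ∞ (ends ∘ f) :=
  ⟨fun h => ⟨h.continuous, fun x => (contMDiffAt_iff.1 (h x)).2⟩,
    fun h x => contMDiffAt_iff.2 ⟨h.1.continuousAt, h.2 x⟩⟩

theorem contMDiff_ends :
    ContMDiff (𝓘(ℝ, E).prod 𝓘(ℝ, E)) (𝓘(ℝ, E).prod 𝓘(ℝ, E)) ∞ (ends : FundArrow M → M × M) :=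
  (contMDiff_iff.1 (contMDiff_id (M := FundArrow M))).2

theorem contMDiff_src :
    ContMDiff (𝓘(ℝ, E).prod 𝓘(ℝ, E)) 𝓘(ℝ, E) ∞ (src : FundArrow M → M) :=
  contMDiff_fst.comp contMDiff_ends

theorem contMDiff_tgt :
    ContMDiff (𝓘(ℝ, E).prod 𝓘(ℝ, E)) 𝓘(ℝ, E) ∞ (tgt : FundArrow M → M) :=
  contMDiff_snd.comp contMDiff_ends

theorem contMDiff_unit : ContMDiff 𝓘(ℝ, E) (𝓘(ℝ, E).prod 𝓘(ℝ, E)) ∞ (groupoid M).unit :=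
  have : LocallyPathConnectedSpace M := ChartedSpace.locallyPathConnectedSpace E M
  contMDiff_iff.2 ⟨continuous_unit, contMDiff_id.prodMk contMDiff_id⟩

/-- A local inverse is continuous, and followed by `ends` it is locally the identity; so it is
smooth by `contMDiffAt_iff`. -/
theorem isLocalDiffeomorph_ends : IsLocalDiffeomorph (𝓘(ℝ, E).prod 𝓘(ℝ, E))
    (𝓘(ℝ, E).prod 𝓘(ℝ, E)) ∞ (ends : FundArrow M → M × M) := by
  intro a
  obtain ⟨d, had, hd⟩ := isLocalHomeomorph_ends_of_charted E M a
  refine ⟨⟨d.toPartialEquiv, d.open_source, d.open_target, ?_, ?_⟩, had, fun x _ => congrFun hd x⟩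
  · have h := contMDiff_ends (E := E) (M := M)
    rw [hd] at h
    exact h.contMDiffOn
  · intro y hy
    refine ContMDiffAt.contMDiffWithinAt ?_
    refine contMDiffAt_iff.2 ⟨d.continuousAt_symm hy, ?_⟩
    refine (contMDiffAt_id (I := 𝓘(ℝ, E).prod 𝓘(ℝ, E)) (H := ModelProd E E) (x := y)).congr_of_eventuallyEq ?_
    filter_upwards [d.open_target.mem_nhds hy] with z hz
    show ends (d.symm z) = z
    rw [hd, d.right_inv hz]

/-- Both branches `d` and `d'` are given by `ends`, so they cancel, and a transition map is a
restriction of one of `M × M`. -/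
instance isManifold [IsManifold 𝓘(ℝ, E) ∞ M] :
    IsManifold (𝓘(ℝ, E).prod 𝓘(ℝ, E)) ∞ (FundArrow M) := by
  have hG : HasGroupoid (FundArrow M) (contDiffGroupoid ∞ (𝓘(ℝ, E).prod 𝓘(ℝ, E))) := by
    refine ⟨?_⟩
    rintro _ _ ⟨d, hd, c, hc, rfl⟩ ⟨d', hd', c', hc', rfl⟩
    have hcc : c.symm.trans c' ∈ contDiffGroupoid ∞ (𝓘(ℝ, E).prod 𝓘(ℝ, E)) :=
      HasGroupoid.compatible hc hc'
    have hs := ((d.trans c).symm.trans (d'.trans c')).open_source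
    refine StructureGroupoid.mem_of_eqOnSource _ (closedUnderRestriction' hcc hs) ⟨?_, ?_⟩
    · rw [OpenPartialHomeomorph.restr_source, hs.interior_eq]
      refine (Set.inter_eq_right.2 ?_).symm
      intro x hx
      simp only [mfld_simps] at hx ⊢
      have : d' (d.symm (c.symm x)) = c.symm x := by
        rw [← hd', hd, d.right_inv hx.1.2]
      exact ⟨hx.1.1, this ▸ hx.2.2⟩
    · intro x hx
      simp only [mfld_simps] at hx ⊢
      rw [← hd', hd, d.right_inv hx.1.2]
  exact IsManifold.mk' _ _ _

/-- T0 suffices, since a T0 topological group is Hausdorff. -/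
theorem t2Space (E : Type*) [NormedAddCommGroup E] [NormedSpace ℝ E] {M : Type*} [TopologicalSpace M]
    [ChartedSpace E M] [Group M] [IsTopologicalGroup M] [T2Space M] : T2Space (FundArrow M) :=
  have : LocallyPathConnectedSpace M := ChartedSpace.locallyPathConnectedSpace E M
  have := t0Space (exists_relSimplyConnected E M)
  inferInstance

end Manifold

end FundArrow

namespace FundArrow

/-! ### Source and target are submersions -/

section Submersion

variable {E : Type*} [NormedAddCommGroup E] [NormedSpace ℝ E]
  {M : Type*} [TopologicalSpace M] [ChartedSpace E M]

/-- In the lifted charts `ends` is the identity, so source and target become the two projections of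
`E × E`. -/
theorem chartAt_symm_ends (a : FundArrow M) {z : ModelProd E E}
    (hz : z ∈ (chartAt (ModelProd E E) a).target) :
    (chartAt E a.src ((chartAt (ModelProd E E) a).symm z).src,
      chartAt E a.tgt ((chartAt (ModelProd E E) a).symm z).tgt) = z := by
  conv_rhs => rw [← (chartAt (ModelProd E E) a).right_inv hz, chartAt_apply]
  rfl

variable [IsManifold 𝓘(ℝ, E) ∞ M]

theorem isSubmersion_src :
    Manifold.IsSubmersion (𝓘(ℝ, E).prod 𝓘(ℝ, E)) 𝓘(ℝ, E) ∞ (src : FundArrow M → M) := by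
  refine ⟨E, inferInstance, inferInstance, fun a => ?_⟩
  refine .mk_of_continuousAt continuous_src.continuousAt (.refl ℝ (E × E))
    (chartAt (ModelProd E E) a) (chartAt E a.src) (mem_chart_source _ _) (mem_chart_source _ _)
    (IsManifold.chart_mem_maximalAtlas _) (IsManifold.chart_mem_maximalAtlas _) fun z hz => ?_
  rw [OpenPartialHomeomorph.extend_target] at hz
  exact congrArg Prod.fst (chartAt_symm_ends a hz.1)

theorem isSubmersion_tgt :
    Manifold.IsSubmersion (𝓘(ℝ, E).prod 𝓘(ℝ, E)) 𝓘(ℝ, E) ∞ (tgt : FundArrow M → M) := by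
  refine ⟨E, inferInstance, inferInstance, fun a => ?_⟩
  -- The normal form of a submersion is the first projection; the swap puts the target coordinate
  -- first.
  refine .mk_of_continuousAt continuous_tgt.continuousAt (.prodComm ℝ E E)
    (chartAt (ModelProd E E) a) (chartAt E a.tgt) (mem_chart_source _ _) (mem_chart_source _ _)
    (IsManifold.chart_mem_maximalAtlas _) (IsManifold.chart_mem_maximalAtlas _) fun z hz => ?_
  rw [OpenPartialHomeomorph.extend_target] at hz
  exact congrArg Prod.snd (chartAt_symm_ends a hz.1)

end Submersion

/-! ### The fundamental groupoid of a connected Lie group is a Lie group-groupoid -/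

section LieGroup

variable {E : Type*} [NormedAddCommGroup E] [NormedSpace ℝ E]
  {M : Type*} [TopologicalSpace M] [ChartedSpace E M] [Group M] [IsTopologicalGroup M]
  [LieGroup 𝓘(ℝ, E) ∞ M]

instance lieGroup : LieGroup (𝓘(ℝ, E).prod 𝓘(ℝ, E)) ∞ (FundArrow M) where
  __ := isManifold
  contMDiff_mul := contMDiff_iff.2 ⟨continuous_mul,
    ((contMDiff_src.comp contMDiff_fst).mul (contMDiff_src.comp contMDiff_snd)).prodMk
      ((contMDiff_tgt.comp contMDiff_fst).mul (contMDiff_tgt.comp contMDiff_snd))⟩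
  contMDiff_inv := contMDiff_iff.2 ⟨continuous_inv, contMDiff_src.inv.prodMk contMDiff_tgt.inv⟩

/-- The formula of `comp_eq_mul` makes sense for all pairs of arrows, so it is a global smooth
extension. -/
theorem comp_smooth : IsSmoothOnSubset ((𝓘(ℝ, E).prod 𝓘(ℝ, E)).prod (𝓘(ℝ, E).prod 𝓘(ℝ, E)))
    (𝓘(ℝ, E).prod 𝓘(ℝ, E)) (groupoid M).composable
    (fun c => (groupoid M).comp c.1.1 c.1.2 c.2) := by
  have h : ContMDiff ((𝓘(ℝ, E).prod 𝓘(ℝ, E)).prod (𝓘(ℝ, E).prod 𝓘(ℝ, E)))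
      (𝓘(ℝ, E).prod 𝓘(ℝ, E)) ∞ (fun c : FundArrow M × FundArrow M =>
        c.1 * ((groupoid M).unit c.2.tgt)⁻¹ * c.2) :=
    (contMDiff_fst.mul (contMDiff_unit.comp (contMDiff_tgt.comp contMDiff_snd)).inv).mul
      contMDiff_snd
  convert h.isSmoothOnSubset (groupoid M).composable using 2 with c
  exact comp_eq_mul c.1.1 c.1.2 c.2

variable [FiniteDimensional ℝ E] [T2Space M] [SecondCountableTopology M] [ConnectedSpace M]

theorem isLieGroupoid :
    IsLieGroupoid (𝓘(ℝ, E).prod 𝓘(ℝ, E)) 𝓘(ℝ, E) (groupoid M) where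
  manifold_arrows :=
    { finiteDimensional := inferInstance
      boundaryless := inferInstance
      isManifold := inferInstance
      secondCountable := by
        have : LocallyPathConnectedSpace M := ChartedSpace.locallyPathConnectedSpace E M
        have := connectedSpace (X := M)
        -- The branch of `ends` at the arrow 1 takes values in the second countable space `M × M`.
        obtain ⟨e, he, -⟩ := isLocalHomeomorph_ends_of_charted E M 1
        exact secondCountableTopology_of_chart_at_one e he }
  manifold_objects := ⟨inferInstance, inferInstance, inferInstance, inferInstance⟩
  t2_objects := inferInstance
  t2_star _ :=
    have := t2Space E (M := M)
    inferInstance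
  src_surjective x := ⟨(groupoid M).unit x, rfl⟩
  tgt_surjective x := ⟨(groupoid M).unit x, rfl⟩
  src_submersion := isSubmersion_src
  tgt_submersion := isSubmersion_tgt
  comp_smooth := comp_smooth

theorem map_isMorphism {X Y : Type*} [TopologicalSpace X] [TopologicalSpace Y] (f : C(X, Y)) :
    (groupoid X).IsMorphism (groupoid Y) (map f) f where
  src_map _ := rfl
  tgt_map _ := rfl
  map_comp := by
    rintro ⟨y, z, q⟩ ⟨x, y', p⟩ h
    obtain rfl : y = y' := h
    induction p using Path.Homotopic.Quotient.ind with | mk p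
    induction q using Path.Homotopic.Quotient.ind with | mk q
    exact congrArg ofPath (Path.map_trans p q f.continuous)

theorem isLieGroupGroupoid :
    IsLieGroupGroupoid (𝓘(ℝ, E).prod 𝓘(ℝ, E)) 𝓘(ℝ, E) (groupoid M) where
  isLieGroupoid := isLieGroupoid
  lieGroup_arrows := inferInstance
  lieGroup_objects := inferInstance
  mul_morphism :=
    { isMorphism := ⟨fun _ => rfl, fun _ => rfl, fun b a h =>
        comp_mul_comp b.1 a.1 b.2 a.2
        (congrArg Prod.fst h) (congrArg Prod.snd h)⟩
      smooth_arrows := contMDiff_mul _ _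
      smooth_objects := contMDiff_mul _ _ }
  one_morphism := ⟨fun _ => rfl, fun _ => rfl, fun _ _ _ => (comp_eq_left (a := (1 : FundArrow M)) rfl rfl).symm⟩
  inv_morphism :=
    { isMorphism := map_isMorphism ⟨fun x : M => x⁻¹, continuous_inv⟩
      smooth_arrows := contMDiff_inv _ _
      smooth_objects := contMDiff_inv _ _ }
  interchange b a d c hba hdc :=
    ⟨congrArg₂ (· * ·) hba hdc, comp_mul_comp b a d c hba hdc⟩

end LieGroup

end FundArrow

/-- A path in the image of a set `A`, on which `e` is a homeomorphism, lifts to a path in `A`. -/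
theorem OpenPartialHomeomorph.exists_path_lift {X Y : Type*} [TopologicalSpace X]
    [TopologicalSpace Y] (e : OpenPartialHomeomorph Y X) {A : Set Y} (hA : A ⊆ e.source)
    {z z' : X} (l : Path z z') (hl : ∀ t, l t ∈ e '' A) {y y' : Y} (hy : y ∈ A) (hy' : y' ∈ A)
    (hz : e y = z) (hz' : e y' = z') :
    ∃ l' : Path y y', (∀ t, l' t ∈ A) ∧ ∀ t, e (l' t) = l t := by
  have hmem : ∀ t, e.symm (l t) ∈ A ∧ e (e.symm (l t)) = l t := fun t => by
    obtain ⟨w, hw, h⟩ := hl t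
    rw [← h, e.left_inv (hA hw)]
    exact ⟨hw, rfl⟩
  refine ⟨⟨⟨fun t => e.symm (l t), e.symm.continuousOn.comp_continuous l.continuous fun t => ?_⟩,
    ?_, ?_⟩, fun t => (hmem t).1, fun t => (hmem t).2⟩
  · rw [← (hmem t).2]
    exact e.map_source (hA (hmem t).1)
  · simp [← hz, e.left_inv (hA hy)]
  · simp [← hz', e.left_inv (hA hy')]

namespace FundArrow

/-! ### Lifting arrows along a covering map -/

section Lifting

variable {X Y : Type*} [TopologicalSpace X] [TopologicalSpace Y] {f : C(Y, X)}

/-- The lift, with source `x`, of an arrow that starts at `f x`. -/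
noncomputable def lift (hf : IsCoveringMap f) (c : FundArrow X) (x : Y) (h : f x = c.src) :
    FundArrow Y :=
  ⟨x, hf.monodromy c.path ⟨x, h⟩, hf.liftPathQuotient c.path ⟨x, h⟩⟩

theorem map_lift (hf : IsCoveringMap f) (c : FundArrow X) (x : Y) (h : f x = c.src) :
    map f (lift hf c x h) = c :=
  ext_cast h (hf.monodromy c.path ⟨x, h⟩).2 (hf.map_liftPathQuotient c.path ⟨x, h⟩)

/-- Both arrows lie over `map f a`, and a covering map is injective on homotopy classes of paths
with fixed end points. -/
theorem lift_map (hf : IsCoveringMap f) (a : FundArrow Y) : lift hf (map f a) a.src rfl = a := by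
  have h : ((hf.monodromy (map f a).path ⟨a.src, rfl⟩ : f ⁻¹' {(map f a).tgt}) : Y) = a.tgt :=
    congrArg Subtype.val (hf.monodromy_map a.path)
  refine ext_cast rfl h (hf.injective_path_homotopic_map _ _ ?_)
  exact (hf.map_liftPathQuotient (map f a).path ⟨a.src, rfl⟩).trans
    (Path.Homotopic.Quotient.map_cast a.path (hx := rfl) (hy := h) (f := f)).symm

/-- Uniqueness of lifts, in the form used to identify a lift by exhibiting a candidate. -/
theorem lift_eq (hf : IsCoveringMap f) {c : FundArrow X} {x : Y} {h : f x = c.src}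
    {a : FundArrow Y} (hc : map f a = c) (hx : a.src = x) : lift hf c x h = a := by
  subst hc hx
  exact lift_map hf a

/-- If `γ` represents the lift at `s`, a nearby arrow is `l·(f ∘ γ)·r` with `l` and `r` in evenly
small sets. These lift to `l'` in `U` and `r'` in `V`, and by uniqueness `l'·γ·r'` is the lift. -/
theorem continuous_lift (hf : IsCoveringMap f) :
    Continuous fun s : {c : FundArrow X × Y | c.1.src = f c.2} =>
      lift hf s.1.1 s.1.2 s.2.symm := by
  refine continuous_iff_continuousAt.2 fun s S hS => Filter.mem_map.2 ?_
  obtain ⟨U, V, hU, hV, haU, haV, hUV⟩ := exists_sheet_subset hS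
  have hmap := map_lift hf s.1.1 s.1.2 s.2.symm
  set a := lift hf s.1.1 s.1.2 s.2.symm with ha
  have hsrc : a.src = s.1.2 := rfl
  clear_value a
  obtain ⟨y, y', γ, rfl⟩ := a.exists_ofPath
  obtain ⟨e, hye, he⟩ := hf.isLocalHomeomorph y
  obtain ⟨e', hye', he'⟩ := hf.isLocalHomeomorph y'
  let A := U ∩ e.source
  let B := V ∩ e'.source
  have hAo : IsOpen A := hU.inter e.open_source
  have hA : IsOpen (e '' A) := e.isOpen_image_of_subset_source hAo Set.inter_subset_right
  have hB : IsOpen (e' '' B) :=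
    e'.isOpen_image_of_subset_source (hV.inter e'.open_source) Set.inter_subset_right
  have hyA : y ∈ A := ⟨haU, hye⟩
  have hyB : y' ∈ B := ⟨haV, hye'⟩
  have hN : {c : FundArrow X × Y | c.1 ∈ sheet (e '' A) (map f (ofPath γ)) (e' '' B) ∧ c.2 ∈ A} ∈
      𝓝 s.1 := by
    refine prod_mem_nhds (s := sheet (e '' A) (map f (ofPath γ)) (e' '' B)) (t := A) ?_ ?_
    · rw [← hmap]
      exact sheet_mem_nhds hA hB ⟨y, hyA, (congrFun he y).symm⟩ ⟨y', hyB, (congrFun he' y').symm⟩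
    · exact hAo.mem_nhds (hsrc ▸ hyA)
  refine Filter.mem_of_superset (continuous_subtype_val.continuousAt.preimage_mem_nhds hN) ?_
  rintro ⟨⟨c, x⟩, hcx⟩ ⟨hc, hx⟩
  refine hUV ?_
  rw [map_ofPath] at hc
  obtain ⟨z, z', l, r, hl, hr, rfl⟩ := mem_sheet_ofPath.1 hc
  -- The point of `B` over the end of `r` is where the lifted path will end.
  obtain ⟨x', hx', hxz'⟩ := hr 1
  -- The prescribed source `x` lies in `A`, where `e` is injective; so the lift of `l` starts at `x`
  -- itself.
  obtain ⟨l', hl', hll'⟩ := e.exists_path_lift Set.inter_subset_right l hl hx hyA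
    ((congrFun he.symm x).trans hcx.symm) (congrFun he.symm y)
  obtain ⟨r', hr', hrr'⟩ := e'.exists_path_lift Set.inter_subset_right r hr hyB hx'
    (congrFun he'.symm y') (hxz'.trans r.target)
  have hlift : map f (ofPath (l'.trans (γ.trans r'))) =
      ofPath (l.trans ((γ.map f.continuous).trans r)) := by
    rw [map_ofPath, Path.map_trans, Path.map_trans]
    refine ofPath_congr fun t => ?_
    rw [← he] at hll'
    rw [← he'] at hrr'
    simp only [Path.trans_apply, Path.map_coe, Function.comp_apply, hll', hrr']
  refine Set.mem_of_eq_of_mem (lift_eq hf hlift rfl) (mem_sheet_ofPath.2 ?_)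
  exact ⟨_, _, l', r', fun t => (hl' t).1, fun t => (hr' t).1, rfl⟩

end Lifting

end FundArrow

/-! ### Pairs of smooth maps on a subset -/

section Smooth

variable {E H E₁ H₁ E₂ H₂ : Type*}
  [NormedAddCommGroup E] [NormedSpace ℝ E] [TopologicalSpace H]
  [NormedAddCommGroup E₁] [NormedSpace ℝ E₁] [TopologicalSpace H₁]
  [NormedAddCommGroup E₂] [NormedSpace ℝ E₂] [TopologicalSpace H₂]
  {I : ModelWithCorners ℝ E H} {I₁ : ModelWithCorners ℝ E₁ H₁} {I₂ : ModelWithCorners ℝ E₂ H₂}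
  {A B₁ B₂ : Type*} [TopologicalSpace A] [ChartedSpace H A] [TopologicalSpace B₁]
  [ChartedSpace H₁ B₁] [TopologicalSpace B₂] [ChartedSpace H₂ B₂]

theorem IsSmoothOnSubset.prodMk {S : Set A} {f₁ : S → B₁} {f₂ : S → B₂}
    (h₁ : IsSmoothOnSubset I I₁ S f₁) (h₂ : IsSmoothOnSubset I I₂ S f₂) :
    IsSmoothOnSubset I (I₁.prod I₂) S (fun x => (f₁ x, f₂ x)) := by
  intro x
  obtain ⟨U₁, F₁, hU₁, hx₁, hF₁, hf₁⟩ := h₁ x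
  obtain ⟨U₂, F₂, hU₂, hx₂, hF₂, hf₂⟩ := h₂ x
  exact ⟨U₁ ∩ U₂, fun y => (F₁ y, F₂ y), hU₁.inter hU₂, ⟨hx₁, hx₂⟩,
    (hF₁.mono Set.inter_subset_left).prodMk (hF₂.mono Set.inter_subset_right),
    fun y hy => Prod.ext (hf₁ y hy.1) (hf₂ y hy.2)⟩

end Smooth

namespace FundArrow

/-! ### The morphism induced by a smooth covering map -/

section Covering

variable {E : Type*} [NormedAddCommGroup E] [NormedSpace ℝ E]
  {M : Type*} [TopologicalSpace M] [ChartedSpace E M]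
  {E' : Type*} [NormedAddCommGroup E'] [NormedSpace ℝ E']
  {M' : Type*} [TopologicalSpace M'] [ChartedSpace E' M']

theorem contMDiff_map {f : C(M', M)} (hf : ContMDiff 𝓘(ℝ, E') 𝓘(ℝ, E) ∞ f) :
    ContMDiff (𝓘(ℝ, E').prod 𝓘(ℝ, E')) (𝓘(ℝ, E).prod 𝓘(ℝ, E)) ∞ (map f) :=
  contMDiff_iff.2 ⟨continuous_map f, (hf.comp contMDiff_src).prodMk (hf.comp contMDiff_tgt)⟩

/-- The lift of an arrow along a smooth covering map depends smoothly on the arrow and the source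
of the lift. -/
theorem isSmoothOnSubset_lift {F K : Type*} [NormedAddCommGroup F] [NormedSpace ℝ F]
    [TopologicalSpace K] {J : ModelWithCorners ℝ F K} {A : Type*} [TopologicalSpace A]
    [ChartedSpace K A] {f : C(M', M)} (hf : IsSmoothCovering 𝓘(ℝ, E') 𝓘(ℝ, E) f)
    {c : A → FundArrow M} {x : A → M'} (hc : ContMDiff J (𝓘(ℝ, E).prod 𝓘(ℝ, E)) ∞ c)
    (hx : ContMDiff J 𝓘(ℝ, E') ∞ x) {S : Set A} (h : ∀ s ∈ S, f (x s) = (c s).src) :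
    IsSmoothOnSubset J (𝓘(ℝ, E').prod 𝓘(ℝ, E')) S
      (fun s => lift hf.isCoveringMap (c s) (x s) (h s s.2)) := by
  let g : S → {c : FundArrow M × M' | c.1.src = f c.2} := fun s => ⟨(c s, x s), (h s s.2).symm⟩
  have hg : Continuous g := ((hc.continuous.comp continuous_subtype_val).prodMk
    (hx.continuous.comp continuous_subtype_val)).subtype_mk _
  have hcont : Continuous fun s : S => lift hf.isCoveringMap (c s) (x s) (h s s.2) :=
    (continuous_lift hf.isCoveringMap).comp hg
  -- Two reductions along local diffeomorphisms: `ends` leaves the source `x s`, which is smooth,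
  -- and the target of the lift; `f` carries that target to the target of `c s`.
  refine .of_comp_isLocalDiffeomorph isLocalDiffeomorph_ends hcont
    (.prodMk (hx.isSmoothOnSubset S) (.of_comp_isLocalDiffeomorph hf.isLocalDiffeomorph
      (continuous_tgt.comp hcont) ?_))
  convert (contMDiff_tgt.comp hc).isSmoothOnSubset S using 2 with s
  exact congrArg tgt (map_lift hf.isCoveringMap (c s) (x s) (h s s.2))

/-- The inverse is path lifting with the constant source `x`. -/
theorem star_diffeo {f : C(M', M)} (hf : IsSmoothCovering 𝓘(ℝ, E') 𝓘(ℝ, E) f) (x : M') :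
    RestrictsToDiffeo (𝓘(ℝ, E').prod 𝓘(ℝ, E')) (𝓘(ℝ, E).prod 𝓘(ℝ, E)) (map f)
      ((groupoid M').star x) ((groupoid M).star (f x)) := by
  have h : ∀ c ∈ (groupoid M).star (f x), f x = c.src := fun c hc => Eq.symm hc
  refine ⟨{
    toFun a := ⟨map f a, congrArg f a.2⟩
    invFun c := ⟨lift hf.isCoveringMap c x (h c c.2), rfl⟩
    left_inv a := Subtype.ext (lift_eq hf.isCoveringMap rfl a.2)
    right_inv c := Subtype.ext (map_lift hf.isCoveringMap _ _ _) }, fun _ => rfl, ?_, ?_⟩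
  · exact (contMDiff_map hf.isLocalDiffeomorph.contMDiff).isSmoothOnSubset _
  · exact isSmoothOnSubset_lift hf contMDiff_id contMDiff_const h

theorem fiberProduct_diffeo {f : C(M', M)} (hf : IsSmoothCovering 𝓘(ℝ, E') 𝓘(ℝ, E) f) :
    RestrictsToDiffeo (𝓘(ℝ, E').prod 𝓘(ℝ, E')) ((𝓘(ℝ, E).prod 𝓘(ℝ, E)).prod 𝓘(ℝ, E'))
      (fun a : FundArrow M' => (map f a, a.src)) Set.univ
      {c : FundArrow M × M' | c.1.src = f c.2} := by
  refine ⟨{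
    toFun a := ⟨(map f a, a.1.src), rfl⟩
    invFun c := ⟨lift hf.isCoveringMap c.1.1 c.1.2 c.2.symm, trivial⟩
    left_inv a := Subtype.ext (lift_map hf.isCoveringMap a.1)
    right_inv c := Subtype.ext (Prod.ext (map_lift hf.isCoveringMap _ _ _) rfl) },
    fun _ => rfl, ?_, ?_⟩
  · exact ((contMDiff_map hf.isLocalDiffeomorph.contMDiff).prodMk contMDiff_src).isSmoothOnSubset _
  · exact isSmoothOnSubset_lift hf contMDiff_fst contMDiff_snd fun c hc => Eq.symm hc

end Covering

theorem map_mul {G G' F : Type*} [TopologicalSpace G] [Group G] [IsTopologicalGroup G]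
    [TopologicalSpace G'] [Group G'] [IsTopologicalGroup G'] [FunLike F G' G]
    [MonoidHomClass F G' G] (p : F) (hp : Continuous p) (a b : FundArrow G') :
    map ⟨p, hp⟩ (a * b) = map ⟨p, hp⟩ a * map ⟨p, hp⟩ b := by
  obtain ⟨_, _, γ, rfl⟩ := a.exists_ofPath
  obtain ⟨_, _, δ, rfl⟩ := b.exists_ofPath
  simp only [ofPath_mul, map_ofPath]
  exact ofPath_congr fun t => by simp

end FundArrow

/-! ### The proposition -/

theorem mainTheorem4
    {E : Type*} [NormedAddCommGroup E] [NormedSpace ℝ E] [FiniteDimensional ℝ E]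
    {E' : Type*} [NormedAddCommGroup E'] [NormedSpace ℝ E'] [FiniteDimensional ℝ E']
    {M : Type*} [TopologicalSpace M] [ChartedSpace E M] [Group M] [IsTopologicalGroup M]
    [LieGroup 𝓘(ℝ, E) ∞ M] [T2Space M] [SecondCountableTopology M] [ConnectedSpace M]
    {M' : Type*} [TopologicalSpace M'] [ChartedSpace E' M'] [Group M'] [IsTopologicalGroup M']
    [LieGroup 𝓘(ℝ, E') ∞ M'] [T2Space M'] [SecondCountableTopology M'] [ConnectedSpace M']
    (p : ContMDiffMonoidMorphism 𝓘(ℝ, E') 𝓘(ℝ, E) ∞ M' M)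
    (hp : IsSmoothCovering 𝓘(ℝ, E') 𝓘(ℝ, E) p) :
    IsLieGroupGroupoidCovering (𝓘(ℝ, E').prod 𝓘(ℝ, E')) 𝓘(ℝ, E') (𝓘(ℝ, E).prod 𝓘(ℝ, E)) 𝓘(ℝ, E)
      (FundArrow.groupoid M') (FundArrow.groupoid M)
      (FundArrow.map ⟨p, p.contMDiff_toFun.continuous⟩) p ∧
    RestrictsToDiffeo (𝓘(ℝ, E').prod 𝓘(ℝ, E')) ((𝓘(ℝ, E).prod 𝓘(ℝ, E)).prod 𝓘(ℝ, E'))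
      (fun a : FundArrow M' => (FundArrow.map ⟨p, p.contMDiff_toFun.continuous⟩ a,
        (FundArrow.groupoid M').src a))
      Set.univ {c : FundArrow M × M' | (FundArrow.groupoid M).src c.1 = p c.2} := by
  let f : C(M', M) := ⟨p, p.contMDiff_toFun.continuous⟩
  have hf : IsSmoothCovering 𝓘(ℝ, E') 𝓘(ℝ, E) f := hp
  refine ⟨⟨⟨FundArrow.isLieGroupGroupoid, FundArrow.isLieGroupGroupoid,
    ⟨FundArrow.map_isMorphism f, FundArrow.contMDiff_map p.contMDiff_toFun, p.contMDiff_toFun⟩,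
    FundArrow.map_mul p p.contMDiff_toFun.continuous, map_mul p⟩, FundArrow.star_diffeo hf⟩,
    FundArrow.fiberProduct_diffeo hf⟩
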